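/- For each $n \in \mathbb{N}$ let $G^{(n)}$ be a finite abelian group, with $|G^{(n)}| \to \infty$, and let $\{Y_a^{(n)} \mid a \in G^{(n)}\}$ be complex random variables which have mean $0$ and are independent except for the constraint $Y_{a^{-1}}^{(n)} = \overline{Y_a^{(n)}}$ (that is, the constraint holds almost surely for every $a$, and every subfamily containing at most one member of each pair $\{Y_a^{(n)}, Y_{a^{-1}}^{(n)}\}$ is independent). Suppose that $\mathbb{E}|Y_a^{(n)}|^2 = 1$ for every $a \in G^{(n)}$, that $\mathbb{E}(Y_a^{(n)})^2 = 0$ whenever $a \neq a^{-1}$, and that for every $\varepsilon > 0$ \[ \lim_{n\to\infty} \frac{1}{|G^{(n)}|} \sum_{a \in G^{(n)}} \mathbb{E}\Bigl(|Y_a^{(n)}|^2 \mathbf{1}_{\{|Y_a^{(n)}| \ge \varepsilon \sqrt{|G^{(n)}|}\}}\Bigr) = 0. \] Let $\mu^{(n)}$ be the empirical spectral measure of the random $G^{(n)}$-circulant matrix $M^{(n)} = \bigl[|G^{(n)}|^{-1/2}\, Y^{(n)}_{ab^{-1}}\bigr]_{a,b \in G^{(n)}}$, that is, $\mu^{(n)}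 = |G^{(n)}|^{-1} \sum_{\lambda} \delta_\lambda$, where $\lambda$ runs over the eigenvalues of $M^{(n)}$ counted with multiplicity. Then $\mu^{(n)}$ converges weakly, in mean and in probability, to the standard real Gaussian measure $\gamma_{\mathbb{R}} = \mathcal{N}(0,1)$ (regarded as a measure on $\mathbb{C}$ carried by $\mathbb{R}$): for every bounded continuous $f : \mathbb{C} \to \mathbb{R}$, $\mathbb{E} \int f \, d\mu^{(n)} \to \int f \, d\gamma_{\mathbb{R}}$, and $\int f \, d\mu^{(n)} \to \int f \, d\gamma_{\mathbb{R}}$ in probability. -/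

import Mathlib

open MeasureTheory ProbabilityTheory Filter Topology
open scoped ENNReal BoundedContinuousFunction ComplexConjugate

noncomputable section

/-- The normalized `G`-circulant matrix `[|G|^{-1/2} y(a b⁻¹)]_{a, b ∈ G}`. -/
def groupCirculant {G : Type*} [CommGroup G] [Fintype G] (y : G → ℂ) : Matrix G G ℂ :=
  Matrix.of fun a b => ((Real.sqrt (Fintype.card G) : ℝ) : ℂ)⁻¹ * y (a * b⁻¹)

/-- The empirical spectral measure of a square complex matrix: the average of the point masses
at its eigenvalues, counted with algebraic multiplicity. -/
def empiricalSpectralMeasure {ι : Type*} [Fintype ι] [DecidableEq ι] (M : Matrix ι ι ℂ) :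
    Measure ℂ :=
  (Fintype.card ι : ℝ≥0∞)⁻¹ • (M.charpoly.roots.map fun z => Measure.dirac z).sum

/-- The standard real Gaussian measure, as a measure on `ℂ` carried by the real line. -/
def realGaussianOnComplex : Measure ℂ :=
  (gaussianReal 0 1).map (fun x : ℝ => (x : ℂ))

/-- The family `Y` satisfies `Y (a⁻¹) = conj (Y a)` almost surely and is otherwise independent:
any subfamily with at most one member from each pair `{a, a⁻¹}` is independent. -/
def IndepUpToConjInv {G Ω : Type*} [CommGroup G] [MeasurableSpace Ω] (Y : G → Ω → ℂ)
    (P : Measure Ω) : Prop :=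
  (∀ a : G, ∀ᵐ ω ∂P, Y a⁻¹ ω = conj (Y a ω)) ∧
  ∀ S : Set G, (∀ a ∈ S, a⁻¹ ∈ S → a⁻¹ = a) → iIndepFun (fun (a : S) => Y a) P

/-- Lindeberg-type condition for a sequence of families of random variables. -/
def LindebergCondition {G : ℕ → Type*} [∀ n, Fintype (G n)] {Ω : ℕ → Type*}
    [∀ n, MeasurableSpace (Ω n)] (P : ∀ n, Measure (Ω n)) (Y : ∀ n, G n → Ω n → ℂ) : Prop :=
  ∀ ε : ℝ, 0 < ε →
    Tendsto (fun n => (1 / (Fintype.card (G n) : ℝ)) *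
        ∑ a : G n, ∫ ω in {ω | ε * Real.sqrt (Fintype.card (G n)) ≤ ‖Y n a ω‖},
          ‖Y n a ω‖ ^ 2 ∂(P n))
      atTop (𝓝 0)

/-- The random measures `μ n` converge to `ν` weakly in mean: `𝔼 (μ n (f)) → ν (f)` for each
bounded continuous `f`. -/
def ConvergesInMean {Ω : ℕ → Type*} [∀ n, MeasurableSpace (Ω n)] (P : ∀ n, Measure (Ω n))
    (μ : ∀ n, Ω n → Measure ℂ) (ν : Measure ℂ) : Prop :=
  ∀ f : ℂ →ᵇ ℝ,
    (∀ n, Integrable (fun ω => ∫ z, f z ∂(μ n ω)) (P n)) ∧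
    Tendsto (fun n => ∫ ω, (∫ z, f z ∂(μ n ω)) ∂(P n)) atTop (𝓝 (∫ z, f z ∂ν))

/-- The random measures `μ n` converge to `ν` weakly in probability: `μ n (f) → ν (f)` in
probability for each bounded continuous `f`. -/
def ConvergesInProbability {Ω : ℕ → Type*} [∀ n, MeasurableSpace (Ω n)]
    (P : ∀ n, Measure (Ω n)) (μ : ∀ n, Ω n → Measure ℂ) (ν : Measure ℂ) : Prop :=
  ∀ f : ℂ →ᵇ ℝ, ∀ ε : ℝ, 0 < ε →
    Tendsto (fun n => P n {ω | ε ≤ |(∫ z, f z ∂(μ n ω)) - ∫ z, f z ∂ν|}) atTop (𝓝 0)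

end

/-! The characters χ of G form a basis of eigenvectors of every G-circulant matrix. Hence the
eigenvalues are λ_χ = |G|^{-1/2} Σ_a χ(a⁻¹) Y_a, almost surely real by the constraint on Y, and ∫ f
dμ is the average of f(λ_χ) over χ. Since |Ĝ| = |G|, E[∫ f dμ ∫ g dμ] is the integral of f ⊗ g
against the law of (λ_χ, λ_ψ) averaged over all pairs of characters.

This averaged law converges to the standard Gaussian law on the plane. For χ ≠ ψ, orthogonality of
characters gives tλ_χ + sλ_ψ variance exactly t² + s². Its coefficients are bounded by |t| + |s|, so
a quantitative Lindeberg estimate (`norm_charFun_symmetric_sum_sub_exp_le`) bounds the error in the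
characteristic function uniformly in χ ≠ ψ. The diagonal pairs have proportion 1/|G|, and Lévy's
continuity theorem applies.

Taking g = 1 gives convergence in mean. Taking g = f gives the second moment, so the variance of ∫ f
dμ tends to 0 and Chebyshev's inequality gives convergence in probability. -/

noncomputable section

/-! ### Elementary estimates for exponentials and products -/

theorem norm_prod_sub_prod_le_sum {ι : Type*} (s : Finset ι) (a b : ι → ℂ)
    (ha : ∀ i, ‖a i‖ ≤ 1) (hb : ∀ i, ‖b i‖ ≤ 1) :
    ‖∏ i ∈ s, a i - ∏ i ∈ s, b i‖ ≤ ∑ i ∈ s, ‖a i - b i‖ := by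
  classical
  induction s using Finset.induction_on with
  | empty => simp
  | insert k s hk ih =>
    rw [Finset.prod_insert hk, Finset.prod_insert hk, Finset.sum_insert hk]
    have hA : ‖∏ i ∈ s, a i‖ ≤ 1 := by
      rw [norm_prod]
      exact Finset.prod_le_one (fun _ _ => norm_nonneg _) fun i _ => ha i
    calc ‖a k * ∏ i ∈ s, a i - b k * ∏ i ∈ s, b i‖
        = ‖(a k - b k) * ∏ i ∈ s, a i + b k * (∏ i ∈ s, a i - ∏ i ∈ s, b i)‖ := by
          congr 1; ring
      _ ≤ ‖a k - b k‖ * ‖∏ i ∈ s, a i‖ + ‖b k‖ * ‖∏ i ∈ s, a i - ∏ i ∈ s, b i‖ := by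
          rw [← norm_mul, ← norm_mul]; exact norm_add_le _ _
      _ ≤ ‖a k - b k‖ * 1 + 1 * ∑ i ∈ s, ‖a i - b i‖ := by
          gcongr
          exact hb k
      _ = _ := by ring

/-- Below the threshold δ the cubic remainder satisfies |x|³ ≤ δx². Above it a multiple of x²
suffices: for |x| > 1 the crude bound 2 + |x| + x²/2 is at most 4x². -/
theorem norm_exp_mul_I_sub_taylor_le {δ : ℝ} (hδ₀ : 0 ≤ δ) (hδ₁ : δ ≤ 1) (x : ℝ) :
    ‖Complex.exp (x * Complex.I) - (1 + x * Complex.I - (x : ℂ) ^ 2 / 2)‖ ≤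
      δ * x ^ 2 + 4 * ({y : ℝ | δ ≤ |y|}.indicator (fun y => y ^ 2) x) := by
  have cubic : |x| ≤ 1 →
      ‖Complex.exp (x * Complex.I) - (1 + x * Complex.I - (x : ℂ) ^ 2 / 2)‖ ≤ |x| ^ 3 := by
    intro h
    have hz : ‖(x : ℂ) * Complex.I‖ = |x| := by simp
    have key := Complex.exp_bound (x := x * Complex.I) (by rw [hz]; exact h)
      (n := 3) (by norm_num)
    rw [hz] at key
    have e : ∑ m ∈ Finset.range 3, ((x : ℂ) * Complex.I) ^ m / (m.factorial : ℂ)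
        = 1 + x * Complex.I - (x : ℂ) ^ 2 / 2 := by
      simp [Finset.sum_range_succ, mul_pow, Complex.I_sq, Nat.factorial]
      ring
    rw [e] at key
    refine key.trans ?_
    have : 0 ≤ |x| ^ 3 := by positivity
    norm_num [Nat.factorial]
    linarith
  rcases lt_or_ge |x| δ with h | h
  · rw [Set.indicator_of_notMem (by simpa using h)]
    refine (cubic (by linarith)).trans ?_
    have : |x| ^ 3 = |x| * x ^ 2 := by rw [← sq_abs x]; ring
    rw [this, mul_zero, add_zero]
    gcongr
  · rw [Set.indicator_of_mem (by simpa using h)]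
    rcases le_or_gt |x| 1 with h1 | h1
    · refine (cubic h1).trans ?_
      have e : |x| ^ 3 = |x| * x ^ 2 := by rw [← sq_abs x]; ring
      nlinarith [sq_nonneg x, mul_nonneg hδ₀ (sq_nonneg x)]
    · have h2 : ‖(1 : ℂ) + x * Complex.I - (x : ℂ) ^ 2 / 2‖ ≤ 1 + |x| + x ^ 2 / 2 := by
        refine (norm_sub_le _ _).trans (add_le_add ((norm_add_le _ _).trans ?_) ?_) <;> simp
      have h3 := (norm_sub_le (Complex.exp (x * Complex.I))
        (1 + x * Complex.I - (x : ℂ) ^ 2 / 2)).trans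
          (add_le_add (Complex.norm_exp_ofReal_mul_I x).le h2)
      have e : x ^ 2 = |x| ^ 2 := (sq_abs x).symm
      rw [e] at h3 ⊢
      nlinarith [mul_nonneg hδ₀ (sq_nonneg |x|)]

theorem norm_exp_neg_sub_one_add_le {v : ℝ} (hv : 0 ≤ v) :
    ‖Complex.exp (-(v / 2 : ℝ)) - (1 - v / 2)‖ ≤ v ^ 2 := by
  have e : Complex.exp (-(v / 2 : ℝ)) - (1 - v / 2)
      = ((Real.exp (-(v / 2)) - 1 - (-(v / 2)) : ℝ) : ℂ) := by
    push_cast; ring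
  rw [e, Complex.norm_real]
  rcases le_or_gt v 2 with h | h
  · refine (Real.norm_exp_sub_one_sub_id_le ?_).trans ?_
    · rw [norm_neg, Real.norm_of_nonneg (by positivity)]; linarith
    · rw [norm_neg, Real.norm_of_nonneg (by positivity)]; nlinarith
  · have h1 : Real.exp (-(v / 2)) ≤ 1 := Real.exp_le_one_iff.2 (by linarith)
    have h2 := Real.exp_pos (-(v / 2))
    rw [Real.norm_eq_abs, abs_le]
    constructor <;> nlinarith

/-! ### A quantitative Lindeberg central limit theorem -/

section Lindeberg

variable {Ω : Type*} [MeasurableSpace Ω] {P : Measure Ω} [IsProbabilityMeasure P]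

/-- Both terms are compared with 1 - v/2, where v is the variance: the first by integrating the
Taylor estimate, whose linear term vanishes by centering, the second at cost v². -/
theorem norm_charFun_sub_exp_le {X : Ω → ℝ} (hm : Measurable X)
    (hi : Integrable (fun ω => X ω ^ 2) P) (h0 : ∫ ω, X ω ∂P = 0)
    {δ : ℝ} (hδ₀ : 0 ≤ δ) (hδ₁ : δ ≤ 1) :
    ‖(∫ ω, Complex.exp (X ω * Complex.I) ∂P)
        - Complex.exp (-((∫ ω, X ω ^ 2 ∂P) / 2 : ℝ))‖ ≤
      δ * (∫ ω, X ω ^ 2 ∂P) + 4 * (∫ ω in {ω | δ ≤ |X ω|}, X ω ^ 2 ∂P)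
        + (∫ ω, X ω ^ 2 ∂P) ^ 2 := by
  set v := ∫ ω, X ω ^ 2 ∂P with hv
  have hv0 : 0 ≤ v := integral_nonneg fun ω => sq_nonneg _
  have hX : Integrable X P :=
    ((memLp_two_iff_integrable_sq hm.aestronglyMeasurable).2 hi).integrable one_le_two
  have hS : MeasurableSet {ω | δ ≤ |X ω|} := measurableSet_le measurable_const hm.abs
  have hexp : Integrable (fun ω => Complex.exp (X ω * Complex.I)) P :=
    Integrable.of_bound (by fun_prop) 1 (ae_of_all _ fun ω => by simp)
  have hX1 : Integrable (fun ω => (X ω : ℂ) * Complex.I) P := hX.ofReal.mul_const _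
  have hX2 : Integrable (fun ω => (X ω : ℂ) ^ 2 / 2) P := by
    simpa using (hi.ofReal (𝕜 := ℂ)).div_const 2
  have hT : Integrable (fun ω => 1 + (X ω : ℂ) * Complex.I - (X ω : ℂ) ^ 2 / 2) P :=
    ((integrable_const _).add hX1).sub hX2
  have iT : ∫ ω, (1 + (X ω : ℂ) * Complex.I - (X ω : ℂ) ^ 2 / 2) ∂P = (1 : ℂ) - (v : ℂ) / 2 := by
    rw [integral_sub (f := fun ω => 1 + (X ω : ℂ) * Complex.I)
        ((integrable_const _).add hX1) hX2,
      integral_add (integrable_const _) hX1,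
      integral_mul_const, integral_complex_ofReal, h0, integral_div]
    have : ∫ ω, (X ω : ℂ) ^ 2 ∂P = (v : ℂ) := by
      rw [hv, ← integral_complex_ofReal]; simp
    simp [this]
  have first : ‖(∫ ω, Complex.exp (X ω * Complex.I) ∂P) - ((1 : ℂ) - (v : ℂ) / 2)‖ ≤
      δ * v + 4 * ∫ ω in {ω | δ ≤ |X ω|}, X ω ^ 2 ∂P := by
    rw [← iT, ← integral_sub hexp hT]
    have i1 : Integrable (fun ω => δ * X ω ^ 2) P := hi.const_mul _
    have i2 : Integrable (fun ω => 4 * {ω | δ ≤ |X ω|}.indicator (fun ω => X ω ^ 2) ω) P :=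
      (hi.indicator hS).const_mul _
    refine (norm_integral_le_of_norm_le (i1.add i2)
      (ae_of_all _ fun ω => norm_exp_mul_I_sub_taylor_le hδ₀ hδ₁ (X ω))).trans_eq ?_
    rw [integral_add' i1 i2, integral_const_mul, integral_const_mul, integral_indicator hS]
  have second := norm_exp_neg_sub_one_add_le hv0
  rw [norm_sub_rev] at second
  exact (norm_sub_le_norm_sub_add_norm_sub _ ((1 : ℂ) - v / 2) _).trans (add_le_add first second)

/-- Independence factors the characteristic function, and the Gaussian factors likewise. All factors
lie in the closed unit disc, so the errors of the single factors add. -/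
theorem norm_charFun_sum_sub_exp_le {ι : Type*} [Fintype ι] {X : ι → Ω → ℝ}
    (hind : iIndepFun X P) (hm : ∀ i, Measurable (X i))
    (hi : ∀ i, Integrable (fun ω => X i ω ^ 2) P) (h0 : ∀ i, ∫ ω, X i ω ∂P = 0)
    {δ : ℝ} (hδ₀ : 0 ≤ δ) (hδ₁ : δ ≤ 1) :
    ‖(∫ ω, Complex.exp ((∑ i, X i ω : ℝ) * Complex.I) ∂P)
        - Complex.exp (-((∑ i, ∫ ω, X i ω ^ 2 ∂P) / 2 : ℝ))‖ ≤
      ∑ i, (δ * (∫ ω, X i ω ^ 2 ∂P) + 4 * (∫ ω in {ω | δ ≤ |X i ω|}, X i ω ^ 2 ∂P)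
        + (∫ ω, X i ω ^ 2 ∂P) ^ 2) := by
  have h1 := congrFun (hind.charFun_map_fun_sum_eq_prod fun i => (hm i).aemeasurable) 1
  have h2 : ∀ Z : Ω → ℝ, Measurable Z →
      charFun (P.map Z) 1 = ∫ ω, Complex.exp (Z ω * Complex.I) ∂P := by
    intro Z hZ
    rw [charFun_apply_real, integral_map hZ.aemeasurable (by fun_prop)]
    simp
  rw [h2 _ (by fun_prop), Finset.prod_apply] at h1
  simp_rw [h2 _ (hm _)] at h1
  have h3 : Complex.exp (-((∑ i, ∫ ω, X i ω ^ 2 ∂P) / 2 : ℝ))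
      = ∏ i, Complex.exp (-((∫ ω, X i ω ^ 2 ∂P) / 2 : ℝ)) := by
    rw [← Complex.exp_sum]; push_cast; rw [Finset.sum_div, Finset.sum_neg_distrib]
  rw [h1, h3]
  refine (norm_prod_sub_prod_le_sum _ _ _ (fun i => ?_) fun i => ?_).trans
    (Finset.sum_le_sum fun i _ => norm_charFun_sub_exp_le (hm i) (hi i) (h0 i) hδ₀ hδ₁)
  · refine (norm_integral_le_integral_norm _).trans ?_
    simp
  · rw [← Complex.ofReal_neg, Complex.norm_exp_ofReal, Real.exp_le_one_iff]
    have : 0 ≤ ∫ ω, X i ω ^ 2 ∂P := integral_nonneg fun ω => sq_nonneg _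
    linarith

end Lindeberg

/-! ### Reduction of the conjugation-symmetric family to independent variables -/

theorem exists_finset_sum_eq_of_inv_invariant (G : Type*) [CommGroup G] [Fintype G]
    [DecidableEq G] :
    ∃ S : Finset G, (∀ a ∈ S, a⁻¹ ∈ S → a⁻¹ = a) ∧
      ∀ g : G → ℝ, (∀ a, g a⁻¹ = g a) →
        ∑ a, g a = ∑ a ∈ S, (if a⁻¹ = a then 1 else 2) * g a := by
  -- The enumeration serves only as a linear order on G, which selects one element from each pair
  -- {a, a⁻¹}.
  let e := Fintype.equivFin G
  refine ⟨Finset.univ.filter fun a => e a ≤ e a⁻¹, fun a ha ha' => ?_, fun g hg => ?_⟩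
  · simp only [Finset.mem_filter, Finset.mem_univ, true_and, inv_inv] at ha ha'
    exact e.injective (le_antisymm ha' ha)
  · have h1 : ∑ a, g a = ∑ a with e a ≤ e a⁻¹, g a + ∑ a with ¬ e a ≤ e a⁻¹, g a :=
      (Finset.sum_filter_add_sum_filter_not _ _ _).symm
    have h2 : ∑ a with ¬ e a ≤ e a⁻¹, g a
        = ∑ a with e a ≤ e a⁻¹, (if a⁻¹ = a then 0 else 1) * g a := by
      simp_rw [ite_mul, zero_mul, one_mul]
      rw [Finset.sum_ite, Finset.sum_const_zero, zero_add, Finset.filter_filter]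
      refine Finset.sum_nbij' (fun a => a⁻¹) (fun a => a⁻¹) ?_ ?_ ?_ ?_ ?_
      · intro a ha
        simp only [Finset.mem_filter, Finset.mem_univ, true_and, not_le, inv_inv] at ha ⊢
        exact ⟨ha.le, fun h => by rw [← h] at ha; exact lt_irrefl _ ha⟩
      · intro a ha
        simp only [Finset.mem_filter, Finset.mem_univ, true_and, not_le, inv_inv] at ha ⊢
        exact lt_of_le_of_ne ha.1 fun h => ha.2 (e.injective h).symm
      · simp
      · simp
      · intro a _; exact (hg a).symm
    rw [h1, h2, ← Finset.sum_add_distrib]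
    refine Finset.sum_congr rfl fun a _ => ?_
    split_ifs <;> ring

section SymmetricFamily

variable {G Ω : Type*} [CommGroup G] [Fintype G] [MeasurableSpace Ω]
  {P : Measure Ω} {Y : G → Ω → ℂ}

theorem integrable_norm_sq_of_integral_eq_one {Z : Ω → ℂ} (h : ∫ ω, ‖Z ω‖ ^ 2 ∂P = 1) :
    Integrable (fun ω => ‖Z ω‖ ^ 2) P := by
  by_contra h'
  rw [integral_undef h'] at h
  exact zero_ne_one h

theorem integral_re_mul_sq_of_real {Z : Ω → ℂ} {z : ℂ} (hz : conj z = z)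
    (hvar : ∫ ω, ‖Z ω‖ ^ 2 ∂P = 1) (hre : ∀ᵐ ω ∂P, conj (Z ω) = Z ω) :
    ∫ ω, (z * Z ω).re ^ 2 ∂P = ‖z‖ ^ 2 := by
  have : (fun ω => (z * Z ω).re ^ 2) =ᵐ[P] fun ω => ‖z‖ ^ 2 * ‖Z ω‖ ^ 2 := by
    filter_upwards [hre] with ω hω
    rw [← mul_pow, ← norm_mul]
    have : conj (z * Z ω) = z * Z ω := by rw [map_mul, hz, hω]
    rw [Complex.conj_eq_iff_re] at this
    conv_rhs => rw [← this]
    rw [Complex.norm_real, Real.norm_eq_abs, sq_abs]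
  rw [integral_congr_ae this, integral_const_mul, hvar, mul_one]

/-- Uses (Re w)² = (|w|² + Re w²)/2 with w = zZ; the second term has mean zero. -/
theorem integral_re_mul_sq_of_integral_sq_eq_zero {Z : Ω → ℂ} (hm : Measurable Z) (z : ℂ)
    (hvar : ∫ ω, ‖Z ω‖ ^ 2 ∂P = 1) (hsq : ∫ ω, Z ω ^ 2 ∂P = 0) :
    ∫ ω, (z * Z ω).re ^ 2 ∂P = ‖z‖ ^ 2 / 2 := by
  have hi := integrable_norm_sq_of_integral_eq_one hvar
  have hi2 : Integrable (fun ω => z ^ 2 * Z ω ^ 2) P := by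
    refine Integrable.const_mul ?_ _
    refine hi.mono' (by fun_prop) (ae_of_all _ fun ω => by simp)
  have : (fun ω => (z * Z ω).re ^ 2)
      = fun ω => (‖z‖ ^ 2 * ‖Z ω‖ ^ 2 + (z ^ 2 * Z ω ^ 2).re) / 2 := by
    ext ω
    rw [← mul_pow, ← mul_pow, ← norm_mul, ← Complex.normSq_eq_norm_sq, Complex.normSq_apply,
      sq (z * Z ω), Complex.mul_re (z * Z ω)]
    ring
  have hre : ∫ ω, (z ^ 2 * Z ω ^ 2).re ∂P = (∫ ω, z ^ 2 * Z ω ^ 2 ∂P).re := integral_re hi2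
  have hi3 : Integrable (fun ω => (z ^ 2 * Z ω ^ 2).re) P := hi2.re
  rw [this, integral_div, integral_add (hi.const_mul _) hi3, integral_const_mul, hvar, hre,
    integral_const_mul, hsq, mul_zero, Complex.zero_re, mul_one, add_zero]

/-- Since Re(h(a)Y_a) is almost surely invariant under a ↦ a⁻¹, the sum reduces to independent terms
over a set of representatives, with weight 1 on involutive elements and 2 elsewhere. The variances
match: a weight 2 contributes 4 · |h(a)|²/2 = |h(a)|² + |h(a⁻¹)|², so the total is the full sum of
|h(a)|² divided by |G|. -/
theorem norm_charFun_symmetric_sum_sub_exp_le [IsProbabilityMeasure P] (hm : ∀ a, Measurable (Y a))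
    (hindep : IndepUpToConjInv Y P) (hmean : ∀ a, ∫ ω, Y a ω ∂P = 0)
    (hvar : ∀ a, ∫ ω, ‖Y a ω‖ ^ 2 ∂P = 1) (hsq : ∀ a, a ≠ a⁻¹ → ∫ ω, Y a ω ^ 2 ∂P = 0)
    {h : G → ℂ} (hconj : ∀ a, h a⁻¹ = conj (h a)) {H : ℝ} (hH : 0 < H) (hh : ∀ a, ‖h a‖ ≤ H)
    {δ : ℝ} (hδ₀ : 0 ≤ δ) (hδ₁ : δ ≤ 1) :
    ‖(∫ ω, Complex.exp (((∑ a, h a * Y a ω).re / √(Fintype.card G) : ℝ) * Complex.I) ∂P)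
        - Complex.exp (-((∑ a, ‖h a‖ ^ 2) / Fintype.card G / 2 : ℝ))‖ ≤
      δ * H ^ 2 + 16 * H ^ 2 * (1 / (Fintype.card G : ℝ) *
          ∑ a, ∫ ω in {ω | δ / (2 * H) * √(Fintype.card G) ≤ ‖Y a ω‖}, ‖Y a ω‖ ^ 2 ∂P)
        + 2 * H ^ 4 / Fintype.card G := by
  classical
  obtain ⟨S, hS, hsum⟩ := exists_finset_sum_eq_of_inv_invariant G
  set N : ℝ := (Fintype.card G : ℝ) with hN
  have hN0 : 0 < N := by rw [hN]; exact_mod_cast Fintype.card_pos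
  have hsN : 0 < √N := Real.sqrt_pos.2 hN0
  have hsN2 : √N ^ 2 = N := Real.sq_sqrt hN0.le
  set c : G → ℝ := fun a => if a⁻¹ = a then 1 else 2 with hc
  have hc1 : ∀ a, 0 ≤ c a := fun a => by simp only [hc]; split_ifs <;> norm_num
  have hc2 : ∀ a, c a ≤ 2 := fun a => by simp only [hc]; split_ifs <;> norm_num
  set φ : G → ℂ → ℝ := fun a z => c a / √N * (h a * z).re with hφ
  set X : G → Ω → ℝ := fun a ω => φ a (Y a ω) with hX
  have hφm : ∀ a, Measurable (φ a) := fun a => by simp only [hφ]; fun_prop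
  have hXm : ∀ a, Measurable (X a) := fun a => (hφm a).comp (hm a)
  have hYi := fun a => integrable_norm_sq_of_integral_eq_one (hvar a)
  have hY2 : ∀ a, MemLp (Y a) 2 P := fun a =>
    (memLp_two_iff_integrable_sq_norm (hm a).aestronglyMeasurable).2 (hYi a)
  have hY1 : ∀ a, Integrable (Y a) P := fun a => (hY2 a).integrable one_le_two
  have hXle : ∀ a ω, |X a ω| ≤ 2 * H / √N * ‖Y a ω‖ := by
    intro a ω
    simp only [hX, hφ]
    rw [abs_mul, abs_of_nonneg (div_nonneg (hc1 a) hsN.le)]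
    calc c a / √N * |(h a * Y a ω).re| ≤ 2 / √N * (H * ‖Y a ω‖) := by
          gcongr
          · exact hc2 a
          · refine (Complex.abs_re_le_norm _).trans ?_
            rw [norm_mul]
            gcongr
            exact hh a
      _ = _ := by ring
  have hXsq : ∀ a ω, X a ω ^ 2 ≤ 4 * H ^ 2 / N * ‖Y a ω‖ ^ 2 := by
    intro a ω
    rw [← sq_abs]
    calc |X a ω| ^ 2 ≤ (2 * H / √N * ‖Y a ω‖) ^ 2 := by gcongr; exact hXle a ω
      _ = 4 * H ^ 2 / √N ^ 2 * ‖Y a ω‖ ^ 2 := by ring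
      _ = _ := by rw [hsN2]
  have hXi : ∀ a, Integrable (fun ω => X a ω ^ 2) P := fun a =>
    ((hYi a).const_mul (4 * H ^ 2 / N)).mono' ((hXm a).pow_const 2).aestronglyMeasurable
      (ae_of_all _ fun ω => by
        rw [Real.norm_of_nonneg (sq_nonneg _)]; exact hXsq a ω)
  have hX0 : ∀ a, ∫ ω, X a ω ∂P = 0 := by
    intro a
    have h1 : ∫ ω, (h a * Y a ω).re ∂P = (∫ ω, h a * Y a ω ∂P).re :=
      integral_re ((hY1 a).const_mul _)
    simp only [hX, hφ]
    rw [integral_const_mul, h1, integral_const_mul, hmean, mul_zero, Complex.zero_re, mul_zero]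
  have hXv : ∀ a, ∫ ω, X a ω ^ 2 ∂P = c a * (‖h a‖ ^ 2 / N) := by
    intro a
    simp only [hX, hφ, mul_pow, div_pow, hsN2]
    rw [integral_const_mul]
    simp only [hc]
    split_ifs with ha
    · rw [integral_re_mul_sq_of_real (by rw [← hconj, ha]) (hvar a)]
      · ring
      · filter_upwards [hindep.1 a] with ω hω
        rw [← hω, ha]
    · rw [integral_re_mul_sq_of_integral_sq_eq_zero (hm a) _ (hvar a) (hsq a (Ne.symm ha))]
      ring
  have hV : ∑ a ∈ S, ∫ ω, X a ω ^ 2 ∂P = (∑ a, ‖h a‖ ^ 2) / N := by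
    simp_rw [hXv]
    rw [Finset.sum_div, hsum (fun a => ‖h a‖ ^ 2 / N) fun a => by simp [hconj]]
  have hVle : (∑ a, ‖h a‖ ^ 2) / N ≤ H ^ 2 := by
    rw [div_le_iff₀ hN0]
    calc ∑ a, ‖h a‖ ^ 2 ≤ ∑ _a : G, H ^ 2 := by gcongr with a; exact hh a
      _ = _ := by simp [hN, mul_comm]
  -- As |X_a| ≤ 2H|Y_a|/√N, the event |X_a| ≥ δ forces |Y_a| ≥ δ√N/(2H), which is where the
  -- Lindeberg threshold comes from.
  have hXtail : ∀ a, ∫ ω in {ω | δ ≤ |X a ω|}, X a ω ^ 2 ∂P ≤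
      4 * H ^ 2 / N * ∫ ω in {ω | δ / (2 * H) * √N ≤ ‖Y a ω‖}, ‖Y a ω‖ ^ 2 ∂P := by
    intro a
    rw [← integral_const_mul]
    have hsub : {ω | δ ≤ |X a ω|} ⊆ {ω | δ / (2 * H) * √N ≤ ‖Y a ω‖} := by
      intro ω hω
      have : δ ≤ 2 * H / √N * ‖Y a ω‖ := le_trans hω (hXle a ω)
      change δ / (2 * H) * √N ≤ ‖Y a ω‖
      calc δ / (2 * H) * √N ≤ 2 * H / √N * ‖Y a ω‖ / (2 * H) * √N := by gcongr
        _ = ‖Y a ω‖ := by field_simp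
    refine (setIntegral_mono (hXi a).integrableOn ((hYi a).const_mul _).integrableOn
      (hXsq a)).trans ?_
    exact setIntegral_mono_set ((hYi a).const_mul _).integrableOn
      (ae_of_all _ fun ω => by positivity) hsub.eventuallyLE
  have hind : iIndepFun (fun a : (S : Set G) => X a) P :=
    (hindep.2 S fun a ha ha' => hS a ha ha').comp (fun a => φ a) fun a => hφm a
  have main := norm_charFun_sum_sub_exp_le hind (fun a => hXm a) (fun a => hXi a)
    (fun a => hX0 a) hδ₀ hδ₁
  have hae : ∀ᵐ ω ∂P, ∑ a : (S : Set G), X a ω = (∑ a, h a * Y a ω).re / √N := by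
    filter_upwards [ae_all_iff.2 hindep.1] with ω hω
    rw [Finset.sum_finset_coe (fun a => X a ω), Complex.re_sum,
      hsum (fun a => (h a * Y a ω).re) fun a => by
        rw [hconj, hω, ← map_mul, Complex.conj_re], Finset.sum_div]
    refine Finset.sum_congr rfl fun a _ => ?_
    simp only [hX, hφ, hc]; ring
  rw [integral_congr_ae (g := fun ω =>
      Complex.exp (((∑ a, h a * Y a ω).re / √N : ℝ) * Complex.I))
      (by filter_upwards [hae] with ω hω; rw [hω]),
    Finset.sum_finset_coe (fun a => ∫ ω, X a ω ^ 2 ∂P), hV,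
    Finset.sum_finset_coe (fun a => δ * (∫ ω, X a ω ^ 2 ∂P) +
      4 * (∫ ω in {ω | δ ≤ |X a ω|}, X a ω ^ 2 ∂P) + (∫ ω, X a ω ^ 2 ∂P) ^ 2)] at main
  refine main.trans ?_
  rw [Finset.sum_add_distrib, Finset.sum_add_distrib, ← Finset.mul_sum, hV]
  have t1 : δ * ((∑ a, ‖h a‖ ^ 2) / N) ≤ δ * H ^ 2 := by gcongr
  have t2 : ∑ a ∈ S, 4 * (∫ ω in {ω | δ ≤ |X a ω|}, X a ω ^ 2 ∂P) ≤
      16 * H ^ 2 * (1 / N *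
        ∑ a, ∫ ω in {ω | δ / (2 * H) * √N ≤ ‖Y a ω‖}, ‖Y a ω‖ ^ 2 ∂P) := by
    calc _ ≤ ∑ a ∈ S, 4 * (4 * H ^ 2 / N *
          ∫ ω in {ω | δ / (2 * H) * √N ≤ ‖Y a ω‖}, ‖Y a ω‖ ^ 2 ∂P) := by
          gcongr with a; exact hXtail a
      _ ≤ ∑ a, 4 * (4 * H ^ 2 / N *
          ∫ ω in {ω | δ / (2 * H) * √N ≤ ‖Y a ω‖}, ‖Y a ω‖ ^ 2 ∂P) := by
          refine Finset.sum_le_sum_of_subset_of_nonneg (Finset.subset_univ _) fun a _ _ => ?_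
          have : 0 ≤ ∫ ω in {ω | δ / (2 * H) * √N ≤ ‖Y a ω‖}, ‖Y a ω‖ ^ 2 ∂P :=
            integral_nonneg fun ω => by positivity
          positivity
      _ = _ := by
          rw [← Finset.mul_sum, ← Finset.mul_sum]; ring
  -- The sum of squared variances is at most the largest variance, at most 2H²/N, times the total
  -- variance, at most H².
  have t3 : ∑ a ∈ S, (∫ ω, X a ω ^ 2 ∂P) ^ 2 ≤ 2 * H ^ 4 / N := by
    calc _ ≤ ∑ a ∈ S, (2 * H ^ 2 / N) * ∫ ω, X a ω ^ 2 ∂P := by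
          refine Finset.sum_le_sum fun a _ => ?_
          rw [sq]
          refine mul_le_mul_of_nonneg_right ?_ (integral_nonneg fun ω => sq_nonneg _)
          rw [hXv, mul_div_assoc]
          gcongr
          · exact hc2 a
          · exact hh a
      _ = 2 * H ^ 2 / N * ((∑ a, ‖h a‖ ^ 2) / N) := by rw [← Finset.mul_sum, hV]
      _ ≤ 2 * H ^ 2 / N * H ^ 2 := by gcongr
      _ = _ := by ring
  linarith

end SymmetricFamily

/-! ### Diagonalization of circulant matrices by characters -/

section Spectrum

variable {G : Type*} [CommGroup G] [Fintype G]

/-- The eigenvalue of `groupCirculant y` whose eigenvector is the character `χ`. -/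
def circulantEigenvalue (y : G → ℂ) (χ : AddChar (Additive G) ℂ) : ℂ :=
  ((√(Fintype.card G : ℝ) : ℝ) : ℂ)⁻¹ * ∑ a : G, χ (-Additive.ofMul a) * y a

theorem card_addChar_additive (G : Type*) [CommGroup G] [Fintype G] :
    Fintype.card (AddChar (Additive G) ℂ) = Fintype.card G :=
  (AddChar.card_eq (α := Additive G)).trans (Fintype.card_congr Additive.toMul)

theorem groupCirculant_mulVec_addChar (y : G → ℂ) (χ : AddChar (Additive G) ℂ) :
    (groupCirculant y).mulVec (fun a => χ (Additive.ofMul a))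
      = circulantEigenvalue y χ • fun a => χ (Additive.ofMul a) := by
  ext a
  simp only [Matrix.mulVec, dotProduct, groupCirculant, Matrix.of_apply, Pi.smul_apply,
    smul_eq_mul, circulantEigenvalue, Finset.mul_sum, Finset.sum_mul]
  -- Substitute c = ab⁻¹, so that χ(b) = χ(c⁻¹)χ(a).
  refine Fintype.sum_equiv ((Equiv.inv G).trans (Equiv.mulLeft a)) _ _ fun b => ?_
  simp only [Equiv.trans_apply, Equiv.inv_apply, Equiv.coe_mulLeft]
  have : χ (Additive.ofMul b)
      = χ (-Additive.ofMul (a * b⁻¹)) * χ (Additive.ofMul a) := by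
    rw [← AddChar.map_add_eq_mul]
    congr 1
    simp
  rw [this]; ring

/-- The characters form a basis of ℂ^G, in which the matrix is diagonal; the characteristic
polynomial does not depend on the basis. This form records multiplicities. -/
theorem charpoly_groupCirculant [DecidableEq G] (y : G → ℂ) :
    (groupCirculant y).charpoly
      = ∏ χ, (Polynomial.X - Polynomial.C (circulantEigenvalue y χ)) := by
  classical
  let b : Module.Basis (AddChar (Additive G) ℂ) ℂ (G → ℂ) :=
    (AddChar.complexBasis (Additive G)).map (LinearEquiv.funCongrLeft ℂ ℂ Additive.ofMul)
  have hb : ∀ χ, b χ = fun a => χ (Additive.ofMul a) := fun χ => by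
    ext a
    simp [b, LinearEquiv.funCongrLeft_apply, LinearMap.funLeft_apply]
  have hM : LinearMap.toMatrix b b (Matrix.toLin' (groupCirculant y))
      = Matrix.diagonal (circulantEigenvalue y) := by
    ext ψ χ
    rw [LinearMap.toMatrix_apply, Matrix.toLin'_apply, hb, groupCirculant_mulVec_addChar, ← hb,
      map_smul, Module.Basis.repr_self, Matrix.diagonal_apply, Finsupp.smul_apply,
      Finsupp.single_apply]
    split_ifs with h1 h2 h2
    · rw [h1]; simp
    · exact absurd h1.symm h2
    · exact absurd h2.symm h1
    · simp
  rw [← Matrix.charpoly_diagonal, ← hM, LinearMap.charpoly_toMatrix,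
    ← LinearMap.charpoly_toMatrix _ (Pi.basisFun ℂ G)]
  congr 1
  exact (LinearMap.toMatrix'_toLin' _).symm

theorem empiricalSpectralMeasure_groupCirculant [DecidableEq G] (y : G → ℂ) :
    empiricalSpectralMeasure (groupCirculant y)
      = (Fintype.card G : ℝ≥0∞)⁻¹ • ∑ χ, Measure.dirac (circulantEigenvalue y χ) := by
  rw [empiricalSpectralMeasure, charpoly_groupCirculant, Polynomial.roots_prod _ _
    (Finset.prod_ne_zero_iff.2 fun χ _ => Polynomial.X_sub_C_ne_zero _)]
  simp_rw [Polynomial.roots_X_sub_C, Multiset.bind_singleton, Multiset.map_map]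
  rfl

theorem integral_empiricalSpectralMeasure_groupCirculant [DecidableEq G] (y : G → ℂ)
    (f : ℂ →ᵇ ℝ) :
    ∫ z, f z ∂(empiricalSpectralMeasure (groupCirculant y))
      = (Fintype.card G : ℝ)⁻¹ * ∑ χ, f (circulantEigenvalue y χ) := by
  rw [empiricalSpectralMeasure_groupCirculant, integral_smul_measure,
    integral_finsetSum_measure fun χ _ => f.integrable _]
  simp

/-- Character values have modulus 1, and the cross term sums to zero because χψ⁻¹ is a nontrivial
character. -/
theorem sum_norm_sq_addChar_combination {χ ψ : AddChar (Additive G) ℂ} (hne : χ ≠ ψ)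
    (t s : ℝ) :
    ∑ a : G, ‖(t : ℂ) * χ (-Additive.ofMul a) + s * ψ (-Additive.ofMul a)‖ ^ 2
      = Fintype.card G * (t ^ 2 + s ^ 2) := by
  have hz : ∑ a : G, χ (Additive.ofMul a) * ψ (-Additive.ofMul a) = 0 := by
    have h1 : χ * ψ⁻¹ ≠ 0 := fun h => hne (mul_inv_eq_one.1 h)
    have h2 := AddChar.sum_eq_zero_iff_ne_zero.2 h1
    rw [← h2]
    refine Fintype.sum_equiv Additive.ofMul _ _ fun a => ?_
    simp [AddChar.mul_apply, AddChar.inv_apply]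
  have key : ∀ a : G, ‖(t : ℂ) * χ (-Additive.ofMul a) + s * ψ (-Additive.ofMul a)‖ ^ 2
      = t ^ 2 + s ^ 2 + 2 * t * s * (χ (Additive.ofMul a) * ψ (-Additive.ofMul a)).re := by
    intro a
    have n1 := AddChar.norm_apply χ (-Additive.ofMul a)
    have n2 := AddChar.norm_apply ψ (-Additive.ofMul a)
    have e : χ (Additive.ofMul a) = conj (χ (-Additive.ofMul a)) := by
      rw [← AddChar.map_neg_eq_conj, neg_neg]
    rw [e]
    have m1 : Complex.normSq (χ (-Additive.ofMul a)) = 1 := by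
      rw [Complex.normSq_eq_norm_sq, n1, one_pow]
    have m2 : Complex.normSq (ψ (-Additive.ofMul a)) = 1 := by
      rw [Complex.normSq_eq_norm_sq, n2, one_pow]
    rw [Complex.normSq_apply] at m1 m2
    rw [← Complex.normSq_eq_norm_sq, Complex.normSq_apply]
    simp only [Complex.add_re, Complex.mul_re, Complex.ofReal_re, Complex.ofReal_im,
      Complex.add_im, Complex.mul_im, Complex.conj_re, Complex.conj_im]
    linear_combination t ^ 2 * m1 + s ^ 2 * m2
  simp_rw [key]
  rw [Finset.sum_add_distrib, ← Finset.mul_sum, ← Complex.re_sum, hz]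
  simp [mul_add]

theorem measurable_circulantEigenvalue {Ω : Type*} [MeasurableSpace Ω] {Y : G → Ω → ℂ}
    (hm : ∀ a, Measurable (Y a)) (χ : AddChar (Additive G) ℂ) :
    Measurable fun ω => circulantEigenvalue (fun a => Y a ω) χ := by
  unfold circulantEigenvalue
  fun_prop

/-- Conjugation sends the summand at a to the summand at a⁻¹, so it only permutes the sum. -/
theorem circulantEigenvalue_re_eq {y : G → ℂ} (hy : ∀ a, y a⁻¹ = conj (y a))
    (χ : AddChar (Additive G) ℂ) :
    ((circulantEigenvalue y χ).re : ℂ) = circulantEigenvalue y χ := by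
  rw [← Complex.conj_eq_iff_re, circulantEigenvalue, map_mul, map_inv₀, Complex.conj_ofReal,
    map_sum]
  congr 1
  refine Fintype.sum_equiv (Equiv.inv G) _ _ fun a => ?_
  simp [hy, ← AddChar.map_neg_eq_conj]

end Spectrum

/-! ### Averages of laws -/

section AverageLaw

variable {ι Ω E : Type*} [Fintype ι] [MeasurableSpace Ω] [MeasurableSpace E]

/-- The average of the laws of a finite family of random variables. -/
def averageLaw (P : Measure Ω) (Z : ι → Ω → E) : Measure E :=
  (Fintype.card ι : ℝ≥0∞)⁻¹ • ∑ i, P.map (Z i)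

theorem isProbabilityMeasure_averageLaw [Nonempty ι] (P : Measure Ω) [IsProbabilityMeasure P]
    {Z : ι → Ω → E} (hZ : ∀ i, Measurable (Z i)) : IsProbabilityMeasure (averageLaw P Z) := by
  constructor
  have : ∀ i, P.map (Z i) Set.univ = 1 := fun i => by
    rw [Measure.map_apply (hZ i) MeasurableSet.univ]; simp
  simp only [averageLaw, Measure.smul_apply, Measure.finsetSum_apply, this, Finset.sum_const,
    Finset.card_univ, nsmul_eq_mul, mul_one, smul_eq_mul]
  exact ENNReal.inv_mul_cancel (by simp) (by simp)

theorem integral_averageLaw {F : Type*} [NormedAddCommGroup F] [NormedSpace ℝ F]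
    [TopologicalSpace E] [BorelSpace E] [SecondCountableTopology E]
    [TopologicalSpace.PseudoMetrizableSpace E] [TopologicalSpace.PseudoMetrizableSpace F]
    (P : Measure Ω) [IsProbabilityMeasure P]
    {Z : ι → Ω → E} (hZ : ∀ i, Measurable (Z i)) {g : E → F} (hg : Continuous g) {C : ℝ}
    (hC : ∀ x, ‖g x‖ ≤ C) :
    ∫ x, g x ∂(averageLaw P Z) = (Fintype.card ι : ℝ)⁻¹ • ∑ i, ∫ ω, g (Z i ω) ∂P := by
  have hp : ∀ i, IsProbabilityMeasure (P.map (Z i)) := fun i =>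
    Measure.isProbabilityMeasure_map (hZ i).aemeasurable
  rw [averageLaw, integral_smul_measure, integral_finsetSum_measure fun i _ =>
    Integrable.of_bound hg.aestronglyMeasurable C (ae_of_all _ hC)]
  simp_rw [integral_map (hZ _).aemeasurable hg.aestronglyMeasurable]
  simp

end AverageLaw

/-! ### Joint law of two eigenvalues, averaged over pairs of characters -/

section PairLaw

variable {G Ω : Type*} [CommGroup G] [Fintype G] [MeasurableSpace Ω]

/-- The real parts of the eigenvalues attached to a pair of characters, as a random point of the
Euclidean plane. -/
def eigenvaluePair (Y : G → Ω → ℂ) (p : AddChar (Additive G) ℂ × AddChar (Additive G) ℂ)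
    (ω : Ω) : WithLp 2 (ℝ × ℝ) :=
  WithLp.toLp 2 ((circulantEigenvalue (fun a => Y a ω) p.1).re,
    (circulantEigenvalue (fun a => Y a ω) p.2).re)

/-- The law of the standard Gaussian vector in the Euclidean plane. -/
def planarGaussian : Measure (WithLp 2 (ℝ × ℝ)) :=
  ((gaussianReal 0 1).prod (gaussianReal 0 1)).map (WithLp.toLp 2)

instance : IsProbabilityMeasure planarGaussian :=
  Measure.isProbabilityMeasure_map (by fun_prop)

variable {P : Measure Ω} [IsProbabilityMeasure P] {Y : G → Ω → ℂ}

theorem measurable_eigenvaluePair (hm : ∀ a, Measurable (Y a))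
    (p : AddChar (Additive G) ℂ × AddChar (Additive G) ℂ) :
    Measurable (eigenvaluePair Y p) := by
  have h1 := measurable_circulantEigenvalue hm p.1
  have h2 := measurable_circulantEigenvalue hm p.2
  unfold eigenvaluePair
  fun_prop

theorem charFun_planarGaussian (x : WithLp 2 (ℝ × ℝ)) :
    charFun planarGaussian x = Complex.exp (-((x.fst ^ 2 + x.snd ^ 2) / 2 : ℝ)) := by
  rw [planarGaussian, charFun_prod, charFun_gaussianReal, charFun_gaussianReal,
    ← Complex.exp_add]
  congr 1
  simp only [WithLp.ofLp_fst, WithLp.ofLp_snd, mul_zero, zero_mul, one_mul, zero_sub, NNReal.coe_one,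
    Complex.ofReal_zero, Complex.ofReal_one]
  push_cast
  ring

/-- The inner product with x is, up to the factor |G|^{-1/2}, the real part of Σ h(a)Y_a with h =
x₁χ̄ + x₂ψ̄. Then |h| ≤ |x₁| + |x₂|, and orthogonality makes the normalized variance exactly |x|².
The bound does not depend on the pair. -/
theorem norm_charFun_eigenvaluePair_sub_le (hm : ∀ a, Measurable (Y a))
    (hindep : IndepUpToConjInv Y P) (hmean : ∀ a, ∫ ω, Y a ω ∂P = 0)
    (hvar : ∀ a, ∫ ω, ‖Y a ω‖ ^ 2 ∂P = 1) (hsq : ∀ a, a ≠ a⁻¹ → ∫ ω, Y a ω ^ 2 ∂P = 0)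
    {p : AddChar (Additive G) ℂ × AddChar (Additive G) ℂ} (hp : p.1 ≠ p.2)
    (x : WithLp 2 (ℝ × ℝ)) {H : ℝ} (hH : 0 < H) (hx : |x.fst| + |x.snd| ≤ H)
    {δ : ℝ} (hδ₀ : 0 ≤ δ) (hδ₁ : δ ≤ 1) :
    ‖(∫ ω, Complex.exp (inner ℝ (eigenvaluePair Y p ω) x * Complex.I) ∂P)
        - charFun planarGaussian x‖ ≤
      δ * H ^ 2 + 16 * H ^ 2 * (1 / (Fintype.card G : ℝ) *
          ∑ a, ∫ ω in {ω | δ / (2 * H) * √(Fintype.card G) ≤ ‖Y a ω‖}, ‖Y a ω‖ ^ 2 ∂P)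
        + 2 * H ^ 4 / Fintype.card G := by
  set h : G → ℂ := fun a =>
    (x.fst : ℂ) * p.1 (-Additive.ofMul a) + x.snd * p.2 (-Additive.ofMul a) with hh
  have hconj : ∀ a, h a⁻¹ = conj (h a) := fun a => by
    simp [hh, ← AddChar.map_neg_eq_conj]
  have hle : ∀ a, ‖h a‖ ≤ H := fun a => by
    refine ((norm_add_le _ _).trans_eq ?_).trans hx
    simp [AddChar.norm_apply]
  have main := norm_charFun_symmetric_sum_sub_exp_le hm hindep hmean hvar hsq hconj hH hle
    hδ₀ hδ₁
  have hcard : (Fintype.card G : ℝ) ≠ 0 := by exact_mod_cast Fintype.card_ne_zero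
  rw [sum_norm_sq_addChar_combination hp, mul_div_cancel_left₀ _ hcard,
    ← charFun_planarGaussian] at main
  convert main using 7 with ω
  rw [WithLp.prod_inner_apply]
  simp only [eigenvaluePair, circulantEigenvalue, ← Complex.ofReal_inv, Complex.re_ofReal_mul, hh,
    add_mul, Finset.sum_add_distrib, mul_assoc, ← Finset.mul_sum, Complex.add_re]
  simp
  ring

/-- Off the diagonal the uniform bound applies. The |G| diagonal pairs among |G|² cost at most 2
each, which adds 2/|G|. -/
theorem norm_charFun_averageLaw_sub_le (hm : ∀ a, Measurable (Y a))
    (hindep : IndepUpToConjInv Y P) (hmean : ∀ a, ∫ ω, Y a ω ∂P = 0)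
    (hvar : ∀ a, ∫ ω, ‖Y a ω‖ ^ 2 ∂P = 1) (hsq : ∀ a, a ≠ a⁻¹ → ∫ ω, Y a ω ^ 2 ∂P = 0)
    (x : WithLp 2 (ℝ × ℝ)) {H : ℝ} (hH : 0 < H) (hx : |x.fst| + |x.snd| ≤ H)
    {δ : ℝ} (hδ₀ : 0 ≤ δ) (hδ₁ : δ ≤ 1) :
    ‖charFun (averageLaw P (eigenvaluePair Y)) x - charFun planarGaussian x‖ ≤
      δ * H ^ 2 + 16 * H ^ 2 * (1 / (Fintype.card G : ℝ) *
          ∑ a, ∫ ω in {ω | δ / (2 * H) * √(Fintype.card G) ≤ ‖Y a ω‖}, ‖Y a ω‖ ^ 2 ∂P)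
        + (2 * H ^ 4 + 2) / Fintype.card G := by
  classical
  set B := δ * H ^ 2 + 16 * H ^ 2 * (1 / (Fintype.card G : ℝ) *
          ∑ a, ∫ ω in {ω | δ / (2 * H) * √(Fintype.card G) ≤ ‖Y a ω‖}, ‖Y a ω‖ ^ 2 ∂P)
        + 2 * H ^ 4 / Fintype.card G with hB
  have hB0 : 0 ≤ B := by
    have : 0 ≤ ∑ a, ∫ ω in {ω | δ / (2 * H) * √(Fintype.card G) ≤ ‖Y a ω‖}, ‖Y a ω‖ ^ 2 ∂P :=
      Finset.sum_nonneg fun a _ => integral_nonneg fun ω => by positivity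
    positivity
  set A := AddChar (Additive G) ℂ
  have hcA : Fintype.card A = Fintype.card G := card_addChar_additive G
  have hN : (0 : ℝ) < Fintype.card G := by exact_mod_cast Fintype.card_pos
  set T := charFun planarGaussian x
  set c : A × A → ℂ := fun p =>
    ∫ ω, Complex.exp (inner ℝ (eigenvaluePair Y p ω) x * Complex.I) ∂P with hc
  have hc1 : ∀ p, ‖c p‖ ≤ 1 := fun p => by
    refine (norm_integral_le_integral_norm _).trans ?_
    simp only [Complex.norm_exp_ofReal_mul_I]
    simp
  have hT1 : ‖T‖ ≤ 1 := norm_charFun_le_one _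
  have hbd : ∀ p : A × A, ‖c p - T‖ ≤ B + if p.1 = p.2 then 2 else 0 := by
    intro p
    split_ifs with hp
    · have := (norm_sub_le (c p) T).trans (add_le_add (hc1 p) hT1)
      linarith
    · rw [add_zero]
      exact norm_charFun_eigenvaluePair_sub_le hm hindep hmean hvar hsq hp x hH hx hδ₀ hδ₁
  have hchar : charFun (averageLaw P (eigenvaluePair Y)) x
      = (Fintype.card (A × A) : ℝ)⁻¹ • ∑ p, c p := by
    rw [charFun_apply, integral_averageLaw P (measurable_eigenvaluePair hm) (by fun_prop)
      (C := 1) (fun y => (Complex.norm_exp_ofReal_mul_I _).le)]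
  have hcAA : (Fintype.card (A × A) : ℝ) = (Fintype.card G : ℝ) ^ 2 := by
    rw [Fintype.card_prod, hcA]; push_cast; ring
  have hdiag : ∑ p : A × A, (if p.1 = p.2 then (2 : ℝ) else 0) = 2 * Fintype.card G := by
    rw [Fintype.sum_prod_type]
    simp [hcA, mul_comm]
  have hT : T = (Fintype.card (A × A) : ℝ)⁻¹ • ∑ _p : A × A, T := by
    rw [Finset.sum_const, Finset.card_univ, ← Nat.cast_smul_eq_nsmul ℝ, smul_smul,
      inv_mul_cancel₀ (by rw [hcAA]; positivity), one_smul]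
  rw [hchar]
  conv_lhs => rw [hT]
  rw [← smul_sub, ← Finset.sum_sub_distrib, norm_smul, hcAA,
    Real.norm_of_nonneg (by positivity)]
  calc ((Fintype.card G : ℝ) ^ 2)⁻¹ * ‖∑ p, (c p - T)‖
      ≤ ((Fintype.card G : ℝ) ^ 2)⁻¹ * ∑ p : A × A, (B + if p.1 = p.2 then 2 else 0) := by
        gcongr
        exact norm_sum_le_of_le _ fun p _ => hbd p
    _ = B + 2 / Fintype.card G := by
        rw [Finset.sum_add_distrib, hdiag, Finset.sum_const, Finset.card_univ, nsmul_eq_mul, hcAA]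
        field_simp
    _ = _ := by rw [hB]; ring

end PairLaw

/-! ### Passage to the limit -/

section Limit

variable {G : ℕ → Type*} [∀ n, CommGroup (G n)] [∀ n, Fintype (G n)]
  {Ω : ℕ → Type*} [∀ n, MeasurableSpace (Ω n)]
  {P : ∀ n, Measure (Ω n)} [∀ n, IsProbabilityMeasure (P n)] {Y : ∀ n, G n → Ω n → ℂ}

theorem tendsto_charFun_averageLaw
    (hcard : Tendsto (fun n => Fintype.card (G n)) atTop atTop)
    (hmeas : ∀ n a, Measurable (Y n a)) (hindep : ∀ n, IndepUpToConjInv (Y n) (P n))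
    (hmean : ∀ n a, ∫ ω, Y n a ω ∂(P n) = 0) (hvar : ∀ n a, ∫ ω, ‖Y n a ω‖ ^ 2 ∂(P n) = 1)
    (hsq : ∀ n a, a ≠ a⁻¹ → ∫ ω, (Y n a ω) ^ 2 ∂(P n) = 0) (hlind : LindebergCondition P Y)
    (x : WithLp 2 (ℝ × ℝ)) :
    Tendsto (fun n => charFun (averageLaw (P n) (eigenvaluePair (Y n))) x) atTop
      (𝓝 (charFun planarGaussian x)) := by
  rw [Metric.tendsto_nhds]
  intro ε hε
  -- The added 1 keeps H positive when x = 0.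
  set H : ℝ := |x.fst| + |x.snd| + 1 with hH
  have hH0 : 0 < H := by positivity
  -- Chosen so that the term δH² takes at most half of ε; with δ fixed, the other terms vanish as n
  -- grows.
  set δ : ℝ := min 1 (ε / (2 * H ^ 2)) with hδ
  have hδ0 : 0 < δ := lt_min one_pos (by positivity)
  have hδH : δ * H ^ 2 ≤ ε / 2 := by
    calc δ * H ^ 2 ≤ ε / (2 * H ^ 2) * H ^ 2 := by gcongr; exact min_le_right _ _
      _ = ε / 2 := by field_simp
  have hlim : Tendsto (fun n => 16 * H ^ 2 * (1 / (Fintype.card (G n) : ℝ) *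
      ∑ a, ∫ ω in {ω | δ / (2 * H) * √(Fintype.card (G n)) ≤ ‖Y n a ω‖}, ‖Y n a ω‖ ^ 2 ∂(P n))
        + (2 * H ^ 4 + 2) / Fintype.card (G n)) atTop (𝓝 0) := by
    have h1 := (hlind (δ / (2 * H)) (by positivity)).const_mul (16 * H ^ 2)
    have h2 := (tendsto_natCast_atTop_atTop (R := ℝ).comp hcard).const_div_atTop (2 * H ^ 4 + 2)
    simpa using h1.add h2
  filter_upwards [hlim.eventually (gt_mem_nhds (half_pos hε))] with n hn
  rw [dist_eq_norm]
  have := norm_charFun_averageLaw_sub_le (hmeas n) (hindep n) (hmean n) (hvar n) (hsq n) x hH0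
    (by rw [hH]; linarith) hδ0.le (min_le_left _ _)
  linarith

variable [∀ n, DecidableEq (G n)]

/-- A product of two averages over characters is one average over pairs. Passing to real parts loses
nothing, since the eigenvalues are almost surely real. -/
theorem integral_empiricalSpectralMeasure_mul {n : ℕ} (hmeas : ∀ a, Measurable (Y n a))
    (hindep : IndepUpToConjInv (Y n) (P n)) (f g : ℂ →ᵇ ℝ) :
    ∫ ω, (∫ z, f z ∂(empiricalSpectralMeasure (groupCirculant fun a => Y n a ω))) *
        (∫ z, g z ∂(empiricalSpectralMeasure (groupCirculant fun a => Y n a ω))) ∂(P n)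
      = ∫ x : WithLp 2 (ℝ × ℝ), f x.fst * g x.snd ∂(averageLaw (P n) (eigenvaluePair (Y n))) := by
  rw [integral_averageLaw (P n) (measurable_eigenvaluePair hmeas) (by fun_prop) (C := ‖f‖ * ‖g‖)
    fun x => by rw [norm_mul]; gcongr <;> exact BoundedContinuousFunction.norm_coe_le_norm _ _,
    ← integral_finsetSum, ← integral_smul]
  · refine integral_congr_ae ?_
    filter_upwards [ae_all_iff.2 hindep.1] with ω hω
    rw [integral_empiricalSpectralMeasure_groupCirculant,
      integral_empiricalSpectralMeasure_groupCirculant, Fintype.card_prod,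
      card_addChar_additive, Fintype.sum_prod_type, mul_mul_mul_comm, Finset.sum_mul_sum,
      ← mul_inv, smul_eq_mul]
    push_cast
    have hre := circulantEigenvalue_re_eq (y := fun a => Y n a ω) hω
    simp only [eigenvaluePair, WithLp.toLp_fst, WithLp.toLp_snd, hre]
  · intro p _
    have hZ := measurable_eigenvaluePair hmeas p
    refine Integrable.of_bound (C := ‖f‖ * ‖g‖) ?_ (ae_of_all _ fun ω => ?_)
    · exact ((by fun_prop : Continuous fun x : WithLp 2 (ℝ × ℝ) =>
        f x.fst * g x.snd).measurable.comp hZ).aestronglyMeasurable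
    · rw [norm_mul]; gcongr <;> exact BoundedContinuousFunction.norm_coe_le_norm _ _

theorem integral_planarGaussian_mul (f g : ℂ →ᵇ ℝ) :
    ∫ x : WithLp 2 (ℝ × ℝ), f x.fst * g x.snd ∂planarGaussian
      = (∫ z, f z ∂realGaussianOnComplex) * ∫ z, g z ∂realGaussianOnComplex := by
  have hc : Continuous fun x : WithLp 2 (ℝ × ℝ) => f x.fst * g x.snd := by fun_prop
  rw [planarGaussian, integral_map (by fun_prop) hc.aestronglyMeasurable, realGaussianOnComplex,
    integral_map (by fun_prop) f.continuous.aestronglyMeasurable,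
    integral_map (by fun_prop) g.continuous.aestronglyMeasurable, ← integral_prod_mul]
  rfl

/-- Lévy's continuity theorem turns the convergence of characteristic functions into weak
convergence in the plane, tested here on f ⊗ g. The limit factors because the coordinates of the
planar Gaussian are independent. -/
theorem tendsto_integral_empiricalSpectralMeasure_mul
    (hcard : Tendsto (fun n => Fintype.card (G n)) atTop atTop)
    (hmeas : ∀ n a, Measurable (Y n a)) (hindep : ∀ n, IndepUpToConjInv (Y n) (P n))
    (hmean : ∀ n a, ∫ ω, Y n a ω ∂(P n) = 0) (hvar : ∀ n a, ∫ ω, ‖Y n a ω‖ ^ 2 ∂(P n) = 1)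
    (hsq : ∀ n a, a ≠ a⁻¹ → ∫ ω, (Y n a ω) ^ 2 ∂(P n) = 0) (hlind : LindebergCondition P Y)
    (f g : ℂ →ᵇ ℝ) :
    Tendsto (fun n => ∫ ω,
        (∫ z, f z ∂(empiricalSpectralMeasure (groupCirculant fun a => Y n a ω))) *
        (∫ z, g z ∂(empiricalSpectralMeasure (groupCirculant fun a => Y n a ω))) ∂(P n))
      atTop (𝓝 ((∫ z, f z ∂realGaussianOnComplex) * ∫ z, g z ∂realGaussianOnComplex)) := by
  let μ : ℕ → ProbabilityMeasure (WithLp 2 (ℝ × ℝ)) := fun n =>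
    ⟨averageLaw (P n) (eigenvaluePair (Y n)),
      isProbabilityMeasure_averageLaw (P n) (measurable_eigenvaluePair (hmeas n))⟩
  let μ₀ : ProbabilityMeasure (WithLp 2 (ℝ × ℝ)) := ⟨planarGaussian, inferInstance⟩
  have hμ : Tendsto μ atTop (𝓝 μ₀) := ProbabilityMeasure.tendsto_of_tendsto_charFun
    (tendsto_charFun_averageLaw hcard hmeas hindep hmean hvar hsq hlind)
  let F : WithLp 2 (ℝ × ℝ) →ᵇ ℝ :=
    f.compContinuous ⟨fun x => (x.fst : ℂ), by fun_prop⟩ *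
      g.compContinuous ⟨fun x => (x.snd : ℂ), by fun_prop⟩
  have := ProbabilityMeasure.tendsto_iff_forall_integral_tendsto.1 hμ F
  rw [← integral_planarGaussian_mul]
  simp_rw [integral_empiricalSpectralMeasure_mul (hmeas _) (hindep _)]
  exact this

end Limit

/-! ### Measurability and boundedness of the linear statistics -/

section Empirical

variable {G Ω : Type*} [CommGroup G] [Fintype G] [DecidableEq G] [MeasurableSpace Ω]

theorem measurable_integral_empiricalSpectralMeasure {Y : G → Ω → ℂ}
    (hm : ∀ a, Measurable (Y a)) (f : ℂ →ᵇ ℝ) :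
    Measurable fun ω =>
      ∫ z, f z ∂(empiricalSpectralMeasure (groupCirculant fun a => Y a ω)) := by
  simp_rw [integral_empiricalSpectralMeasure_groupCirculant]
  exact (Finset.measurable_sum _ fun χ _ =>
    f.continuous.measurable.comp (measurable_circulantEigenvalue hm χ)).const_mul _

theorem abs_integral_empiricalSpectralMeasure_le (y : G → ℂ) (f : ℂ →ᵇ ℝ) :
    |∫ z, f z ∂(empiricalSpectralMeasure (groupCirculant y))| ≤ ‖f‖ := by
  have hN : (0 : ℝ) < Fintype.card G := by exact_mod_cast Fintype.card_pos
  rw [integral_empiricalSpectralMeasure_groupCirculant, abs_mul, abs_of_nonneg (by positivity)]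
  calc (Fintype.card G : ℝ)⁻¹ * |∑ χ, f (circulantEigenvalue y χ)|
      ≤ (Fintype.card G : ℝ)⁻¹ * ∑ _χ : AddChar (Additive G) ℂ, ‖f‖ := by
        gcongr
        exact (Finset.abs_sum_le_sum_abs _ _).trans
          (Finset.sum_le_sum fun χ _ => f.norm_coe_le_norm _)
    _ = ‖f‖ := by
        rw [Finset.sum_const, Finset.card_univ, card_addChar_additive, nsmul_eq_mul]
        field_simp

theorem integral_one_empiricalSpectralMeasure (y : G → ℂ) :
    ∫ z, (1 : ℂ →ᵇ ℝ) z ∂(empiricalSpectralMeasure (groupCirculant y)) = 1 := by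
  rw [integral_empiricalSpectralMeasure_groupCirculant]
  simp

end Empirical

/-! ### The second-moment method and the main theorem -/

instance : IsProbabilityMeasure realGaussianOnComplex :=
  Measure.isProbabilityMeasure_map (by fun_prop)

/-- Expanding the square, E(S - m)² tends to m² - 2m² + m² = 0; Chebyshev's inequality concludes. -/
theorem tendsto_measure_abs_sub_ge_of_tendsto_moments {Ω : ℕ → Type*}
    [∀ n, MeasurableSpace (Ω n)] {P : ∀ n, Measure (Ω n)} [∀ n, IsProbabilityMeasure (P n)]
    {S : ∀ n, Ω n → ℝ} (hS : ∀ n, MemLp (S n) 2 (P n)) {m : ℝ}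
    (h1 : Tendsto (fun n => ∫ ω, S n ω ∂(P n)) atTop (𝓝 m))
    (h2 : Tendsto (fun n => ∫ ω, S n ω * S n ω ∂(P n)) atTop (𝓝 (m * m))) {ε : ℝ} (hε : 0 < ε) :
    Tendsto (fun n => P n {ω | ε ≤ |S n ω - m|}) atTop (𝓝 0) := by
  have hD : ∀ n, Integrable (fun ω => (S n ω - m) ^ 2) (P n) := fun n =>
    ((hS n).sub (memLp_const m)).integrable_sq
  have hval : ∀ n, ∫ ω, (S n ω - m) ^ 2 ∂(P n)
      = (∫ ω, S n ω * S n ω ∂(P n)) - 2 * m * (∫ ω, S n ω ∂(P n)) + m * m := by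
    intro n
    have i1 : Integrable (fun ω => S n ω * S n ω) (P n) := by
      simpa [sq] using (hS n).integrable_sq
    have i2 : Integrable (fun ω => 2 * m * S n ω) (P n) :=
      ((hS n).integrable one_le_two).const_mul _
    have e : (fun ω => (S n ω - m) ^ 2)
        = fun ω => S n ω * S n ω - 2 * m * S n ω + m * m := by ext ω; ring
    rw [e, integral_add (f := fun ω => S n ω * S n ω - 2 * m * S n ω) (i1.sub i2)
      (integrable_const _), integral_sub i1 i2, integral_const_mul]
    simp
  have hlim : Tendsto (fun n => ∫ ω, (S n ω - m) ^ 2 ∂(P n)) atTop (𝓝 0) := by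
    simp_rw [hval]
    have := (h2.sub (h1.const_mul (2 * m))).add_const (m * m)
    convert this using 2
    ring
  have hle : ∀ n, P n {ω | ε ≤ |S n ω - m|} ≤
      ENNReal.ofReal ((∫ ω, (S n ω - m) ^ 2 ∂(P n)) / ε ^ 2) := by
    intro n
    have hs : {ω | ε ≤ |S n ω - m|} ⊆ {ω | ε ^ 2 ≤ (S n ω - m) ^ 2} := fun ω hω => by
      change ε ^ 2 ≤ _
      rw [← sq_abs (S n ω - m)]
      exact pow_le_pow_left₀ hε.le hω 2
    refine (measure_mono hs).trans ?_
    rw [ENNReal.le_ofReal_iff_toReal_le (measure_ne_top _ _)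
      (div_nonneg (integral_nonneg fun ω => sq_nonneg _) (sq_nonneg ε)),
      le_div_iff₀' (by positivity)]
    exact mul_meas_ge_le_integral_of_nonneg (ae_of_all _ fun ω => sq_nonneg _) (hD n) _
  refine tendsto_of_tendsto_of_tendsto_of_le_of_le tendsto_const_nhds ?_ (fun _ => zero_le) hle
  have := ENNReal.tendsto_ofReal (hlim.div_const (ε ^ 2))
  simpa using this

end

theorem theoremT
    {G : ℕ → Type*} [∀ n, CommGroup (G n)] [∀ n, Fintype (G n)] [∀ n, DecidableEq (G n)]
    {Ω : ℕ → Type*} [∀ n, MeasurableSpace (Ω n)]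
    (P : ∀ n, Measure (Ω n)) [∀ n, IsProbabilityMeasure (P n)]
    (Y : ∀ n, G n → Ω n → ℂ)
    (hcard : Tendsto (fun n => Fintype.card (G n)) atTop atTop)
    (hmeas : ∀ n a, Measurable (Y n a))
    (hindep : ∀ n, IndepUpToConjInv (Y n) (P n))
    (hmean : ∀ n a, ∫ ω, Y n a ω ∂(P n) = 0)
    (hvar : ∀ n a, ∫ ω, ‖Y n a ω‖ ^ 2 ∂(P n) = 1)
    (hsq : ∀ n a, a ≠ a⁻¹ → ∫ ω, (Y n a ω) ^ 2 ∂(P n) = 0)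
    (hlind : LindebergCondition P Y) :
    ConvergesInMean P
        (fun n ω => empiricalSpectralMeasure (groupCirculant fun a => Y n a ω))
        realGaussianOnComplex ∧
      ConvergesInProbability P
        (fun n ω => empiricalSpectralMeasure (groupCirculant fun a => Y n a ω))
        realGaussianOnComplex := by
  have hmem : ∀ (f : ℂ →ᵇ ℝ) n, MemLp (fun ω =>
      ∫ z, f z ∂(empiricalSpectralMeasure (groupCirculant fun a => Y n a ω))) 2 (P n) :=
    fun f n => MemLp.of_bound
      (measurable_integral_empiricalSpectralMeasure (hmeas n) f).aestronglyMeasurable ‖f‖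
      (ae_of_all _ fun ω => abs_integral_empiricalSpectralMeasure_le _ f)
  have hprod := tendsto_integral_empiricalSpectralMeasure_mul hcard hmeas hindep hmean hvar hsq
    hlind
  have hlim : ∀ f : ℂ →ᵇ ℝ, Tendsto (fun n => ∫ ω,
      (∫ z, f z ∂(empiricalSpectralMeasure (groupCirculant fun a => Y n a ω))) ∂(P n)) atTop
      (𝓝 (∫ z, f z ∂realGaussianOnComplex)) := fun f => by
    -- Each spectral measure has total mass 1, so the product limit with g = 1 is the limit of the
    -- means.
    have := hprod f 1
    simp_rw [integral_one_empiricalSpectralMeasure] at this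
    simpa using this
  exact ⟨fun f => ⟨fun n => (hmem f n).integrable one_le_two, hlim f⟩,
    fun f ε hε => tendsto_measure_abs_sub_ge_of_tendsto_moments (hmem f) (hlim f) (hprod f f) hε⟩
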